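/- For integers $n,d\ge 1$ let $h_n(d)$ denote the minimum number of hamiltonian cycles (counted as subgraphs) over all hamiltonian $d$-regular finite simple graphs of order $n$, with $h_n(d):=\infty$ if no such graph exists. For $d\ge 5$ and $n\ge 1$ put $$f(n,d) := (d-1)^2\,[(d-2)!]^{\frac{n}{d+1}}.$$ Then for all integers $k\ge 0$ and $d\ge 5$, with $n := d^2+d-4+(d+1)k$, $$h_n(d)\ \le\ 2\,[(d-1)!]^{d-2}\,[(d-2)!]^k\ <\ f(n,d).$$ Consequently, Haythorpe's conjecture fails for every $d\ge 5$: for no integer $d\ge 5$ is it true that, for all $n\ge d+3$, every hamiltonian $d$-regular graph of order $n$ has at least $f(n,d)$ hamiltonian cycles. -/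

import Mathlib

open scoped Nat

/-- The hamiltonian cycles of a graph, each recorded by its set of edges. A cycle and its edge set
determine each other, so neither the starting vertex nor the direction of travel is counted. -/
def hamiltonianCycles {V : Type*} [DecidableEq V] (G : SimpleGraph V) : Set (Set (Sym2 V)) :=
  {E | ∃ (a : V) (p : G.Walk a a), p.IsHamiltonianCycle ∧ E = {e | e ∈ p.edges}}

open Classical in
/-- `G` is a `d`-regular graph that has a hamiltonian cycle. -/
def IsHamiltonianRegular {n : ℕ} (G : SimpleGraph (Fin n)) (d : ℕ) : Prop :=
  G.IsRegularOfDegree d ∧ (hamiltonianCycles G).Nonempty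

/-- `h_n(d)`: the minimum number of hamiltonian cycles over all hamiltonian `d`-regular graphs of
order `n`. It is `⊤` (infinity) if there is no such graph. -/
noncomputable def minHamiltonianCycles (n d : ℕ) : ℕ∞ :=
  ⨅ (G : SimpleGraph (Fin n)) (_ : IsHamiltonianRegular G d), (hamiltonianCycles G).encard

/-- The conjectured lower bound `f(n,d) = (d-1)^2 [(d-2)!]^{n/(d+1)}` (used for `2 ≤ d`). -/
noncomputable def haythorpeBound (n d : ℕ) : ℝ :=
  ((d : ℝ) - 1) ^ 2 * (((d - 2)! : ℕ) : ℝ) ^ ((n : ℝ) / ((d : ℝ) + 1))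

/-- Haythorpe's conjecture for a fixed degree `d`: for every `n ≥ d + 3`, every hamiltonian
`d`-regular graph of order `n` has at least `f(n,d)` hamiltonian cycles. -/
def HaythorpeConjecture (d : ℕ) : Prop :=
  ∀ n : ℕ, d + 3 ≤ n → ∀ G : SimpleGraph (Fin n), IsHamiltonianRegular G d →
    haythorpeBound n d ≤ ((hamiltonianCycles G).ncard : ℝ)

namespace FewHamiltonianCycles

/-! ### Consecutive entries and runs in lists -/

section Lists
variable {α : Type*}

/-! Write `d = m + 3`. The upper bound comes from an explicit `d`-regular graph `fewGraph m k` in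
which 2-edge cuts force almost every edge of a hamiltonian cycle. Each unit is a complete graph on
`d + 1` vertices without the edge joining its first and last vertex. Units `0, …, m` are strung
between consecutive vertices of the family `x`. Behind unit `m` hangs a chain of `k` further units;
every unit of the chain except its final one also lacks the edge between its last two vertices,
which carry the two links to the next unit.

A single unit `c < m`, or all units from some `c ≥ m` on, is separated from the rest by two edges,
so a hamiltonian cycle uses both (`exists_path_of_cut`, `entry_leave_mem_edges`). Hence the inner `x
i` are saturated, and the cycle must run straight through the path `y 0, …, y (m + 1)` and join its
ends to `x 0` and `x (m + 1)`, in one of two ways. In the `k` linked units the last vertex is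
saturated too, which leaves a path with fixed ends through `m + 3` vertices: at most `(m + 1)!`
choices. Each of the other `m + 1` units allows at most `(m + 2)!`. The cycle is determined by these
choices (`edges_subset_of_agree`), and the product is the stated bound.

After cancelling common factors, the comparison with `f(n,d)` no longer involves `k`: it becomes `2
(m+2)^(m-1) < (m+1)!^(2(m+2)/(m+4))`, which is reduced to inequalities between integers. -/

theorem pair_infix_append {a b : α} {X Y : List α} :
    [a, b] <:+: X ++ Y ↔
      [a, b] <:+: X ∨ [a, b] <:+: Y ∨ (X.getLast? = some a ∧ Y.head? = some b) := by
  induction X with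
  | nil => simp
  | cons x X ih =>
    rw [List.cons_append, List.infix_cons_iff, List.infix_cons_iff, ih]
    rcases X with _ | ⟨x', X⟩
    · have h : ¬ [a, b] <:+: ([] : List α) := fun h => by simpa using h.length_le
      have h' : ¬ [a, b] <+: [x] := fun h => by simpa using h.length_le
      rw [List.nil_append, List.getLast?_singleton, Option.some_inj, eq_comm (a := x)]
      rcases Y with _ | ⟨y, Y⟩
      · simp [h, h']
      · rw [List.cons_prefix_cons, List.cons_prefix_cons, List.head?_cons, Option.some_inj,
          eq_comm (a := y)]
        simp only [h, h', List.nil_prefix, and_true, false_or]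
        tauto
    · simp [List.cons_prefix_cons, List.getLast?_cons_cons]; tauto

/-- The edges joining consecutive entries of a list. -/
def pathEdges (l : List α) : Set (Sym2 α) := {e | ∃ a b, [a, b] <:+: l ∧ e = s(a, b)}

theorem mk_mem_pathEdges {l : List α} {a b : α} :
    s(a, b) ∈ pathEdges l ↔ [a, b] <:+: l ∨ [b, a] <:+: l := by
  constructor
  · rintro ⟨x, y, h, e⟩
    rcases Sym2.eq_iff.1 e with ⟨rfl, rfl⟩ | ⟨rfl, rfl⟩
    · exact Or.inl h
    · exact Or.inr h
  · rintro (h | h)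
    · exact ⟨_, _, h, rfl⟩
    · exact ⟨_, _, h, Sym2.eq_swap⟩

theorem pathEdges_reverse (l : List α) : pathEdges l.reverse = pathEdges l := by
  have key : ∀ a b : α, [a, b] <:+: l.reverse ↔ [b, a] <:+: l := fun a b => by
    rw [← List.reverse_infix]; simp
  ext e
  induction e with
  | _ a b => rw [mk_mem_pathEdges, mk_mem_pathEdges, key, key, or_comm]

theorem mem_of_pair_infix {a b : α} {l : List α} (h : [a, b] <:+: l) : a ∈ l ∧ b ∈ l :=
  ⟨h.subset (by simp), h.subset (by simp)⟩

/-- A list that starts and ends outside `A` and meets `A` has a first maximal run inside `A`. -/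
theorem exists_first_run (A : Set α) {L : List α} {x y : α} (hx : L.head? = some x) (hxA : x ∉ A)
    (hy : L.getLast? = some y) (hyA : y ∉ A) (hA : ∃ v ∈ L, v ∈ A) :
    ∃ S₁ S₂ S₃ a₁ a₂ b₂ b₃, L = S₁ ++ (S₂ ++ S₃) ∧ (∀ v ∈ S₁, v ∉ A) ∧ (∀ v ∈ S₂, v ∈ A) ∧
      S₁.getLast? = some a₁ ∧ S₂.head? = some a₂ ∧ S₂.getLast? = some b₂ ∧ S₃.head? = some b₃ ∧
      b₃ ∉ A := by
  classical
  set p : α → Bool := fun v => decide (v ∉ A) with hp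
  set q : α → Bool := fun v => decide (v ∈ A) with hq
  set R := L.dropWhile p with hR
  have h1 : L = L.takeWhile p ++ (R.takeWhile q ++ R.dropWhile q) := by
    rw [List.takeWhile_append_dropWhile, List.takeWhile_append_dropWhile]
  have hm1 : ∀ v ∈ L.takeWhile p, v ∉ A := fun v hv => by
    simpa [hp] using List.mem_takeWhile_imp hv
  have hm2 : ∀ v ∈ R.takeWhile q, v ∈ A := fun v hv => by
    simpa [hq] using List.mem_takeWhile_imp hv
  have n1 : L.takeWhile p ≠ [] := by
    rcases L with _ | ⟨z, L⟩
    · simp at hx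
    · simp at hx; subst hx; simp [hp, hxA]
  have nR : R ≠ [] := by
    intro h
    obtain ⟨v, hv, hvA⟩ := hA
    rw [hR, List.dropWhile_eq_nil_iff] at h
    have := h v hv
    simp [hp, hvA] at this
  have n2 : R.takeWhile q ≠ [] := by
    rcases hRR : R with _ | ⟨z, R'⟩
    · exact absurd hRR nR
    · have hz : p z = false := by
        have : (L.dropWhile p).head? = some z := by rw [← hR, hRR]; rfl
        have h2 := List.head?_dropWhile_not p L
        rw [this] at h2
        simpa using h2
      have : z ∈ A := by simpa [hp] using hz
      simp [hq, this]
  have n3 : R.dropWhile q ≠ [] := by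
    intro h
    rw [h, List.append_nil] at h1
    rw [h1, List.getLast?_append_of_ne_nil _ n2] at hy
    exact hyA (hm2 y (List.mem_of_getLast? hy))
  refine ⟨L.takeWhile p, R.takeWhile q, R.dropWhile q, _, _, _, _, h1, hm1, hm2,
    List.getLast?_eq_some_getLast n1, List.head?_eq_some_head n2, List.getLast?_eq_some_getLast n2,
    List.head?_eq_some_head n3, ?_⟩
  have := List.head_dropWhile_not q n3
  simpa [hq] using this

end Lists

/-! ### Counting paths with prescribed ends -/

section PathFamily
variable {α : Type*} [DecidableEq α]

open Classical in
/-- The edge sets of the paths from `s` to `t` that run through all of `A`. -/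
noncomputable def pathFamily (A : Finset α) (s t : α) : Finset (Set (Sym2 α)) :=
  ((A.erase s).erase t).toList.permutations.toFinset.image fun l => pathEdges (s :: (l ++ [t]))

/-- Only the order of the inner vertices is free. Adjacency in a graph is ignored, which is harmless
for an upper bound. -/
theorem card_pathFamily_le {A : Finset α} {s t : α} (hs : s ∈ A) (ht : t ∈ A) (hst : s ≠ t) :
    (pathFamily A s t).card ≤ (A.card - 2)! := by
  classical
  refine Finset.card_image_le.trans ((List.toFinset_card_le _).trans ?_)
  rw [List.length_permutations, Finset.length_toList,
    Finset.card_erase_of_mem (Finset.mem_erase.2 ⟨hst.symm, ht⟩), Finset.card_erase_of_mem hs,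
    Nat.sub_sub]

theorem pathEdges_mem_pathFamily {A : Finset α} {s t : α} (hst : s ≠ t) {l : List α}
    (hl : l.Nodup) (hA : ∀ v, v ∈ l ↔ v ∈ A) (hs : l.head? = some s) (ht : l.getLast? = some t) :
    pathEdges l ∈ pathFamily A s t := by
  classical
  rcases l with _ | ⟨z, l⟩
  · simp at hs
  obtain rfl : z = s := by simpa using hs
  rcases l.eq_nil_or_concat' with rfl | ⟨l, w, rfl⟩
  · simp [hst] at ht
  obtain rfl : w = t := by
    rw [← List.cons_append, List.getLast?_concat] at ht; simpa using ht
  refine Finset.mem_image.2 ⟨l, ?_, rfl⟩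
  rw [List.mem_toFinset, List.mem_permutations]
  refine (List.perm_ext_iff_of_nodup ?_ (Finset.nodup_toList _)).2 fun v => ?_
  · exact (List.nodup_append.1 (List.nodup_cons.1 hl).2).1
  · rw [Finset.mem_toList, Finset.mem_erase, Finset.mem_erase, ← hA]
    simp only [List.nodup_cons, List.mem_append, List.mem_singleton, List.nodup_append] at hl
    simp only [List.mem_cons, List.mem_append, List.not_mem_nil, or_false]
    constructor
    · intro hv
      refine ⟨?_, ?_, Or.inr (Or.inl hv)⟩
      · rintro rfl; exact hl.2.2.2 v hv v rfl rfl
      · rintro rfl; exact hl.1 (Or.inl hv)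
    · tauto

end PathFamily

/-! ### Hamiltonian cycles across a 2-edge cut -/

section Cut
variable {V : Type*} [DecidableEq V] {G : SimpleGraph V}

/-- If a hamiltonian cycle leaves `A` only through `s s'` and `t t'`, then it uses both of these
edges, and inside `A` it is a path from `s` to `t` through all of `A`. -/
theorem exists_path_of_cut {r : V} {p : G.Walk r r} (hp : p.IsHamiltonianCycle) (A : Set V)
    {s s' t t' : V} (hs : s ∈ A) (ht : t ∈ A) (hst : s ≠ t) (hs' : s' ∉ A)
    (H : ∀ a ∈ A, ∀ b ∉ A, s(a, b) ∈ p.edges → a = s ∧ b = s' ∨ a = t ∧ b = t') :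
    s(s, s') ∈ p.edges ∧ s(t, t') ∈ p.edges ∧ ∃ l : List V, l.Nodup ∧ (∀ v, v ∈ l ↔ v ∈ A) ∧
      l.head? = some s ∧ l.getLast? = some t ∧
      ∀ a ∈ A, ∀ b ∈ A, (s(a, b) ∈ p.edges ↔ s(a, b) ∈ pathEdges l) := by
  -- Starting the cycle outside `A` keeps the base point from splitting a run inside `A`.
  have hmem := hp.mem_support s'
  set c := p.rotate s' hmem with hc
  have hcH : c.IsHamiltonianCycle := hp.rotate hmem
  have hce : ∀ e, e ∈ p.edges ↔ e ∈ c.edges := fun e => (p.rotate_edges s' hmem).perm.mem_iff.symm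
  simp only [hce] at H ⊢
  obtain ⟨S₁, S₂, S₃, a₁, a₂, b₂, b₃, hL, h1, h2, ha₁, ha₂, hb₂, hb₃, hb₃A⟩ :=
    exists_first_run A (L := c.support) (x := s') (y := s')
      (by rw [List.head?_eq_some_head c.support_ne_nil]; simp) hs'
      (by rw [List.getLast?_eq_some_getLast c.support_ne_nil]; simp) hs'
      ⟨s, hcH.mem_support s, hs⟩
  have hall := hcH.mem_support
  have htail : c.support.tail.Nodup := hcH.isCycle.support_nodup
  have hE : ∀ a b, s(a, b) ∈ c.edges ↔ [a, b] <:+: c.support ∨ [b, a] <:+: c.support :=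
    fun a b => SimpleGraph.Walk.infix_support_iff_mem_edges.symm
  have hlen := hcH.isCycle.three_le_length
  have hlen' := c.length_support
  rw [hL] at hE hall htail hlen'
  have a₁A : a₁ ∉ A := h1 _ (List.mem_of_getLast? ha₁)
  have a₂A : a₂ ∈ A := h2 _ (List.mem_of_head? ha₂)
  have b₂A : b₂ ∈ A := h2 _ (List.mem_of_getLast? hb₂)
  have e₁ : s(a₂, a₁) ∈ c.edges := by
    rw [hE]; right; rw [pair_infix_append]; right; right
    exact ⟨ha₁, by simp [ha₂]⟩
  have e₂ : s(b₂, b₃) ∈ c.edges := by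
    rw [hE]; left; rw [pair_infix_append, pair_infix_append]; right; left; right; right
    exact ⟨hb₂, hb₃⟩
  have n1 : S₁ ≠ [] := by rintro rfl; simp at ha₁
  obtain ⟨z, S₁', rfl⟩ := List.exists_cons_of_ne_nil n1
  simp only [List.cons_append, List.tail_cons] at htail
  have hd23 : (S₂ ++ S₃).Nodup := htail.of_append_right
  have hdisj : ∀ v ∈ S₂, v ∉ S₃ := fun v hv hv' => (List.nodup_append.1 hd23).2.2 v hv v hv' rfl
  have H₁ := H _ a₂A _ a₁A e₁
  have H₂ := H _ b₂A _ hb₃A e₂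
  -- the two crossings are distinct
  have hne : a₂ ≠ b₂ := by
    intro hab
    -- Since `s ≠ t`, equal inner ends put both crossings in the same case of `H`, so the outer ends
    -- agree too.
    have hmeet : a₁ = b₃ := by
      rcases H₁ with ⟨h, h'⟩ | ⟨h, h'⟩ <;> rcases H₂ with ⟨k, k'⟩ | ⟨k, k'⟩
      · rw [h', k']
      · exact absurd (h.symm.trans (hab.trans k)) hst
      · exact absurd (k.symm.trans (hab.symm.trans h)) hst
      · rw [h', k']
    have hS₂ : S₂ = [a₂] := by
      rcases S₂ with _ | ⟨w, S₂⟩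
      · simp at ha₂
      obtain rfl : w = a₂ := by simpa using ha₂
      rcases S₂.eq_nil_or_concat' with rfl | ⟨S₂, w', rfl⟩
      · rfl
      · have : w' = b₂ := by
          rw [← List.cons_append, List.getLast?_concat] at hb₂; simpa using hb₂
        have := (List.nodup_cons.1 hd23.of_append_left).1
        simp_all
    have hS₁ : S₁' = [] := by
      by_contra hne
      have hm : a₁ ∈ S₁' := by
        obtain ⟨S, w, rfl⟩ := S₁'.eq_nil_or_concat'.resolve_left hne
        have : w = a₁ := by
          rw [← List.cons_append, List.getLast?_concat] at ha₁; simpa using ha₁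
        simp [this]
      exact (List.nodup_append.1 htail).2.2 a₁ hm a₁
        (List.mem_append_right _ (hmeet ▸ List.mem_of_head? hb₃)) rfl
    have hz : z = a₁ := by subst hS₁; simpa using ha₁
    have hzs : z = s' := by
      have h := congrArg List.head? hL
      rw [List.head?_eq_some_head c.support_ne_nil] at h
      simpa [eq_comm] using h
    have hS₃ : S₃ = [b₃] := by
      rcases S₃ with _ | ⟨w, S₃⟩
      · simp at hb₃
      obtain rfl : w = b₃ := by simpa using hb₃
      rcases S₃.eq_nil_or_concat' with rfl | ⟨S₃, w', rfl⟩
      · rfl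
      · have h := congrArg List.getLast? hL
        rw [List.getLast?_eq_some_getLast c.support_ne_nil] at h
        have : w' = s' := by
          rw [← List.cons_append, ← List.append_assoc, ← List.append_assoc,
            List.getLast?_concat] at h
          simpa [eq_comm] using h
        have := (List.nodup_cons.1 hd23.of_append_right).1
        simp_all
    -- The closed walk would be `s', a₂, s'`, of length 2, but a cycle has length at least 3.
    subst hS₁ hS₂ hS₃
    simp at hlen'
    omega
  have hends : (a₂ = s ∧ a₁ = s') ∧ (b₂ = t ∧ b₃ = t') ∨
      (a₂ = t ∧ a₁ = t') ∧ (b₂ = s ∧ b₃ = s') := by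
    rcases H₁ with h | h <;> rcases H₂ with k | k
    · exact absurd (h.1.trans k.1.symm) hne
    · exact Or.inl ⟨h, k⟩
    · exact Or.inr ⟨h, k⟩
    · exact absurd (h.1.trans k.1.symm) hne
  have hendm : ∀ v, v = s ∨ v = t → v ∈ S₂ := by
    have := List.mem_of_head? ha₂
    have := List.mem_of_getLast? hb₂
    rcases hends with ⟨h, k⟩ | ⟨h, k⟩ <;> rintro v (rfl | rfl) <;> simp_all
  -- the cycle never comes back to `A`
  have h3 : ∀ v ∈ S₃, v ∉ A := by
    by_contra! hcon
    obtain ⟨v, hv, hvA⟩ := hcon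
    classical
    obtain ⟨X, w, Y, hXY, hX, hw⟩ : ∃ X w Y, S₃ = X ++ w :: Y ∧ (∀ v ∈ X, v ∉ A) ∧ w ∈ A := by
      clear * - hv hvA
      induction S₃ with
      | nil => simp at hv
      | cons x S ih =>
        by_cases hx : x ∈ A
        · exact ⟨[], x, S, rfl, by simp, hx⟩
        · have : v ∈ S := by
            rcases List.mem_cons.1 hv with rfl | h
            · exact absurd hvA hx
            · exact h
          obtain ⟨X, w, Y, h, h', h''⟩ := ih this
          exact ⟨x :: X, w, Y, by rw [h]; rfl, by simpa [hx] using h', h''⟩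
    have hXn : X ≠ [] := by
      rintro rfl
      rw [hXY] at hb₃
      have : w = b₃ := by simpa using hb₃
      exact hb₃A (this ▸ hw)
    obtain ⟨X', u, rfl⟩ := X.eq_nil_or_concat'.resolve_left hXn
    have hu : u ∉ A := hX u (by simp)
    have he : s(w, u) ∈ c.edges := by
      rw [hE]; right; rw [pair_infix_append, pair_infix_append, hXY, pair_infix_append]
      right; left; right; left; right; right; simp
    -- A second entry into `A` would again be at `s` or `t`, both already visited in `S₂`.
    have := H w hw u hu he
    exact hdisj w (hendm w (by tauto)) (by rw [hXY]; simp)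
  have hS₂A : ∀ v, v ∈ S₂ ↔ v ∈ A := by
    refine fun v => ⟨h2 v, fun hv => ?_⟩
    have := hall v
    rw [List.mem_append, List.mem_append] at this
    rcases this with h | h | h
    · exact absurd hv (h1 v h)
    · exact h
    · exact absurd hv (h3 v h)
  have hpair : ∀ a ∈ A, ∀ b ∈ A, ([a, b] <:+: (z :: S₁') ++ (S₂ ++ S₃) ↔ [a, b] <:+: S₂) := by
    intro a ha b hb
    rw [pair_infix_append, pair_infix_append]
    constructor
    · rintro (h | (h | h | h) | h)
      · exact absurd ha (h1 a (mem_of_pair_infix h).1)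
      · exact h
      · exact absurd ha (h3 a (mem_of_pair_infix h).1)
      · exact absurd hb (h3 b (List.mem_of_head? h.2))
      · exact absurd ha (h1 a (List.mem_of_getLast? h.1))
    · tauto
  have hin : ∀ a ∈ A, ∀ b ∈ A, (s(a, b) ∈ c.edges ↔ s(a, b) ∈ pathEdges S₂) := by
    intro a ha b hb
    rw [hE, mk_mem_pathEdges, hpair a ha b hb, hpair b hb a ha]
  rcases hends with ⟨⟨h, h'⟩, k, k'⟩ | ⟨⟨h, h'⟩, k, k'⟩
  · subst h h' k k'
    exact ⟨e₁, e₂, S₂, hd23.of_append_left, hS₂A, ha₂, hb₂, hin⟩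
  · subst h h' k k'
    refine ⟨e₂, e₁, S₂.reverse, List.nodup_reverse.2 hd23.of_append_left, by simpa using hS₂A,
      by simpa using hb₂, by simpa using ha₂, ?_⟩
    rwa [pathEdges_reverse]

/-- Every vertex has exactly two neighbours on a hamiltonian cycle. -/
theorem exists_two_neighbors {r : V} {p : G.Walk r r} (hp : p.IsHamiltonianCycle) (v : V) :
    ∃ a b, a ≠ b ∧ ∀ w, s(v, w) ∈ p.edges ↔ w = a ∨ w = b := by
  have h := hp.isCycle.ncard_neighborSet_toSubgraph_eq_two (hp.mem_support v)
  obtain ⟨a, b, hab, h⟩ := Set.ncard_eq_two.1 h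
  refine ⟨a, b, hab, fun w => ?_⟩
  have : w ∈ p.toSubgraph.neighborSet v ↔ w ∈ ({a, b} : Set V) := by rw [h]
  rw [← SimpleGraph.Walk.mem_edges_toSubgraph, SimpleGraph.Subgraph.mem_edgeSet]
  simpa using this

end Cut

/-! ### The graph -/

/-- The vertices of the graph `fewGraph m k`: two families `x`, `y` and `m + k + 1` units of `m + 4`
vertices each. -/
inductive Vertex (m k : ℕ)
  | x (i : Fin (m + 2))
  | y (i : Fin (m + 2))
  | u (c : Fin (m + k + 1)) (t : Fin (m + 4))
  deriving DecidableEq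

namespace Vertex
variable {m k : ℕ}

/-- A vertex belongs to one of the families `x`, `y`, or to a unit. -/
def equivSum (m k : ℕ) :
    Vertex m k ≃ Fin (m + 2) ⊕ Fin (m + 2) ⊕ Fin (m + k + 1) × Fin (m + 4) where
  toFun
    | x i => .inl i
    | y i => .inr (.inl i)
    | u c t => .inr (.inr (c, t))
  invFun
    | .inl i => x i
    | .inr (.inl i) => y i
    | .inr (.inr (c, t)) => u c t
  left_inv := by rintro (_ | _ | _) <;> rfl
  right_inv := by rintro (_ | _ | ⟨_, _⟩) <;> rfl

instance : Fintype (Vertex m k) := Fintype.ofEquiv _ (equivSum m k).symm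

theorem card_eq : Fintype.card (Vertex m k) = 2 * (m + 2) + (m + k + 1) * (m + 4) := by
  rw [Fintype.card_congr (equivSum m k)]
  simp only [Fintype.card_sum, Fintype.card_prod, Fintype.card_fin]
  ring

/-- Adjacency inside unit `c`: all pairs except the first and the last vertex and, in the units
`m, …, m + k - 1`, the last two vertices. -/
def Inside (m k c t t' : ℕ) : Prop :=
  t ≠ t' ∧ ¬ (t = 0 ∧ t' = m + 3) ∧ ¬ (t = m + 3 ∧ t' = 0) ∧
    (m ≤ c → c < m + k → ¬ (t = m + 2 ∧ t' = m + 3) ∧ ¬ (t = m + 3 ∧ t' = m + 2))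

/-- Adjacency from unit `c` to the following unit. -/
def Next (m c t c' t' : ℕ) : Prop :=
  m ≤ c ∧ c' = c + 1 ∧ (t = m + 2 ∧ t' = 0 ∨ t = m + 3 ∧ t' = m + 3)

/-- Adjacency between `x i` and unit `c`. -/
def Attach (m i c t : ℕ) : Prop :=
  c ≤ m ∧ (t = 0 ∧ c = i ∨ t = m + 3 ∧ c + 1 = i)

/-- The adjacency relation of `fewGraph`. -/
def Adj : Vertex m k → Vertex m k → Prop
  | x _, x _ => False
  | x i, y j => i = j → i.val = 0 ∨ i.val = m + 1
  | y j, x i => i = j → i.val = 0 ∨ i.val = m + 1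
  | y i, y j => i.val + 1 = j.val ∨ j.val + 1 = i.val
  | x i, u c t => Attach m i c t
  | u c t, x i => Attach m i c t
  | y _, u _ _ => False
  | u _ _, y _ => False
  | u c t, u c' t' => c = c' ∧ Inside m k c t t' ∨ Next m c t c' t' ∨ Next m c' t' c t

theorem Adj.symm : ∀ {v w : Vertex m k}, Adj v w → Adj w v := by
  rintro (i | i | ⟨c, t⟩) (j | j | ⟨c', t'⟩) h <;> simp only [Adj] at h ⊢ <;>
    first | exact h | exact h.symm | grind [Inside]

/-- The outer neighbour of the first vertex of unit `c`. -/
def entry (c : Fin (m + k + 1)) : Vertex m k :=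
  if h : c.val ≤ m then x ⟨c, by omega⟩ else u ⟨c - 1, by omega⟩ ⟨m + 2, by omega⟩

/-- The outer neighbour of the last vertex of unit `c` that lies before this unit. -/
def leave (c : Fin (m + k + 1)) : Vertex m k :=
  if h : c.val ≤ m then x ⟨c + 1, by omega⟩ else u ⟨c - 1, by omega⟩ (Fin.last _)

theorem adj_zero {c : Fin (m + k + 1)} {w : Vertex m k} :
    Adj (u c 0) w ↔ w = entry c ∨ ∃ t : Fin (m + 4), w = u c t ∧ t ≠ 0 ∧ t ≠ Fin.last _ := by
  rcases w with i | i | ⟨c', t'⟩ <;> simp only [Adj, entry, Attach, Inside, Next] <;>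
    grind

theorem adj_last {c : Fin (m + k + 1)} {w : Vertex m k} :
    Adj (u c (Fin.last _)) w ↔ w = leave c ∨
      (∃ c' : Fin (m + k + 1), m ≤ c.val ∧ c'.val = c.val + 1 ∧ w = u c' (Fin.last _)) ∨
      ∃ t : Fin (m + 4), w = u c t ∧ t ≠ 0 ∧ t ≠ Fin.last _ ∧
        (m ≤ c.val → c.val < m + k → t.val ≠ m + 2) := by
  rcases w with i | i | ⟨c', t'⟩ <;> simp only [Adj, leave, Attach, Inside, Next] <;>
    grind

theorem adj_middle {c : Fin (m + k + 1)} {t : Fin (m + 4)} (h0 : t ≠ 0) (hl : t ≠ Fin.last _)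
    {w : Vertex m k} :
    Adj (u c t) w ↔
      (∃ c' : Fin (m + k + 1), t.val = m + 2 ∧ m ≤ c.val ∧ c'.val = c.val + 1 ∧ w = u c' 0) ∨
      ∃ t' : Fin (m + 4), w = u c t' ∧ t' ≠ t ∧
        (t.val = m + 2 → m ≤ c.val → c.val < m + k → t'.val ≠ m + 3) := by
  rcases w with i | i | ⟨c', t'⟩ <;> simp only [Adj, Attach, Inside, Next] <;>
    grind

end Vertex

open Vertex

/-- The `(m + 3)`-regular graph with few hamiltonian cycles. -/
def fewGraph (m k : ℕ) : SimpleGraph (Vertex m k) where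
  Adj := Adj
  symm := ⟨fun _ _ => Adj.symm⟩
  loopless := ⟨by rintro (i | i | ⟨c, t⟩) <;> simp [Vertex.Adj, Inside, Next]⟩

theorem fewGraph_adj {m k : ℕ} {v w : Vertex m k} : (fewGraph m k).Adj v w ↔ Vertex.Adj v w :=
  Iff.rfl

/-! ### Regularity -/

section Regular
variable {m k : ℕ}

/-- Unit `c`, as an embedding. -/
def uEmb (c : Fin (m + k + 1)) : Fin (m + 4) ↪ Vertex m k := ⟨u c, fun _ _ h => by simpa using h⟩

/-- The family `x`, as an embedding. -/
def xEmb (m k : ℕ) : Fin (m + 2) ↪ Vertex m k := ⟨x, fun _ _ h => by simpa using h⟩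

/-- The family `y`, as an embedding. -/
def yEmb (m k : ℕ) : Fin (m + 2) ↪ Vertex m k := ⟨y, fun _ _ h => by simpa using h⟩

@[simp] theorem uEmb_apply (c : Fin (m + k + 1)) (t : Fin (m + 4)) :
    uEmb (m := m) c t = u c t := rfl

@[simp] theorem xEmb_apply (i : Fin (m + 2)) : xEmb m k i = x i := rfl

@[simp] theorem yEmb_apply (i : Fin (m + 2)) : yEmb m k i = y i := rfl

theorem entry_ne (c : Fin (m + k + 1)) (t : Fin (m + 4)) : entry c ≠ u c t := by
  unfold entry; split_ifs <;> simp [Fin.ext_iff]; omega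

theorem leave_ne (c : Fin (m + k + 1)) (t : Fin (m + 4)) : leave c ≠ u c t := by
  unfold leave; split_ifs <;> simp [Fin.ext_iff]; omega

/-- A full unit would give degree `m + 3`, and every edge missing at a vertex is replaced by one
edge leaving the unit. -/
theorem exists_neighbors_unit (c : Fin (m + k + 1)) (t : Fin (m + 4)) :
    ∃ S : Finset (Vertex m k), (∀ w, w ∈ S ↔ Vertex.Adj (u c t) w) ∧ S.card = m + 3 := by
  have he := entry_ne c
  have hl := leave_ne c
  have h0l : (0 : Fin (m + 4)) ≠ Fin.last _ := by simp [Fin.ext_iff]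
  by_cases ht0 : t = 0
  · subst ht0
    refine ⟨insert (entry c) (((Finset.univ.erase 0).erase (Fin.last _)).map (uEmb c)),
      fun w => ?_, ?_⟩
    · rw [adj_zero]
      simp only [Finset.mem_insert, Finset.mem_map, Finset.mem_erase, Finset.mem_univ, uEmb_apply,
        and_true]
      grind
    · rw [Finset.card_insert_of_notMem, Finset.card_map, Finset.card_erase_of_mem,
        Finset.card_erase_of_mem] <;>
        first | (simp; done) | grind [uEmb_apply]
  by_cases htl : t = Fin.last _
  · subst htl
    by_cases hc : m ≤ c.val ∧ c.val < m + k
    · refine ⟨insert (leave c) (insert (u ⟨c + 1, by omega⟩ (Fin.last _))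
        ((((Finset.univ.erase 0).erase (Fin.last _)).erase ⟨m + 2, by omega⟩).map (uEmb c))),
        fun w => ?_, ?_⟩
      · rw [adj_last]
        simp only [Finset.mem_insert, Finset.mem_map, Finset.mem_erase, Finset.mem_univ, uEmb_apply,
          and_true]
        grind
      · have : leave c ≠ u ⟨c + 1, by omega⟩ (Fin.last _) := by
          unfold leave; split_ifs <;> simp [Fin.ext_iff]
        rw [Finset.card_insert_of_notMem, Finset.card_insert_of_notMem, Finset.card_map,
          Finset.card_erase_of_mem, Finset.card_erase_of_mem, Finset.card_erase_of_mem] <;>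
        first | (simp; done) | grind [uEmb_apply]
    · refine ⟨insert (leave c) (((Finset.univ.erase 0).erase (Fin.last _)).map (uEmb c)),
        fun w => ?_, ?_⟩
      · rw [adj_last]
        simp only [Finset.mem_insert, Finset.mem_map, Finset.mem_erase, Finset.mem_univ, uEmb_apply,
          and_true]
        grind
      · rw [Finset.card_insert_of_notMem, Finset.card_map, Finset.card_erase_of_mem,
          Finset.card_erase_of_mem] <;>
        first | (simp; done) | grind [uEmb_apply]
  by_cases hc : t.val = m + 2 ∧ m ≤ c.val ∧ c.val < m + k
  · refine ⟨insert (u ⟨c + 1, by omega⟩ 0)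
      (((Finset.univ.erase t).erase (Fin.last _)).map (uEmb c)), fun w => ?_, ?_⟩
    · rw [adj_middle ht0 htl]
      simp only [Finset.mem_insert, Finset.mem_map, Finset.mem_erase, Finset.mem_univ, uEmb_apply,
        and_true]
      grind
    · rw [Finset.card_insert_of_notMem, Finset.card_map, Finset.card_erase_of_mem,
        Finset.card_erase_of_mem] <;>
        first | (simp; done) | grind [uEmb_apply]
  · refine ⟨(Finset.univ.erase t).map (uEmb c), fun w => ?_, by simp⟩
    rw [adj_middle ht0 htl]
    simp only [Finset.mem_map, Finset.mem_erase, Finset.mem_univ, uEmb_apply, and_true]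
    grind

theorem exists_neighbors_x (i : Fin (m + 2)) :
    ∃ S : Finset (Vertex m k), (∀ w, w ∈ S ↔ Vertex.Adj (x i) w) ∧ S.card = m + 3 := by
  by_cases h0 : i.val = 0
  · refine ⟨insert (u 0 0) (Finset.univ.map (yEmb m k)), fun w => ?_, ?_⟩
    · simp only [Finset.mem_insert, Finset.mem_map, Finset.mem_univ, yEmb_apply, true_and]
      rcases w with j | j | ⟨c, t⟩ <;> grind [Vertex.Adj, Attach]
    · rw [Finset.card_insert_of_notMem] <;> simp
  by_cases hl : i.val = m + 1
  · refine ⟨insert (u ⟨m, by omega⟩ (Fin.last _)) (Finset.univ.map (yEmb m k)), fun w => ?_, ?_⟩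
    · simp only [Finset.mem_insert, Finset.mem_map, Finset.mem_univ, yEmb_apply, true_and]
      rcases w with j | j | ⟨c, t⟩ <;> grind [Vertex.Adj, Attach]
    · rw [Finset.card_insert_of_notMem] <;> simp
  · refine ⟨insert (u ⟨i, by omega⟩ 0) (insert (u ⟨i - 1, by omega⟩ (Fin.last _))
      ((Finset.univ.erase i).map (yEmb m k))), fun w => ?_, ?_⟩
    · simp only [Finset.mem_insert, Finset.mem_map, Finset.mem_erase, Finset.mem_univ, yEmb_apply,
        and_true]
      rcases w with j | j | ⟨c, t⟩ <;> grind [Vertex.Adj, Attach]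
    · rw [Finset.card_insert_of_notMem, Finset.card_insert_of_notMem] <;> simp

theorem exists_neighbors_y (i : Fin (m + 2)) :
    ∃ S : Finset (Vertex m k), (∀ w, w ∈ S ↔ Vertex.Adj (y i) w) ∧ S.card = m + 3 := by
  by_cases h0 : i.val = 0
  · refine ⟨insert (y ⟨1, by omega⟩) (Finset.univ.map (xEmb m k)), fun w => ?_, ?_⟩
    · simp only [Finset.mem_insert, Finset.mem_map, Finset.mem_univ, xEmb_apply, true_and]
      rcases w with j | j | ⟨c, t⟩ <;> grind [Vertex.Adj, Attach]
    · rw [Finset.card_insert_of_notMem] <;> simp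
  by_cases hl : i.val = m + 1
  · refine ⟨insert (y ⟨m, by omega⟩) (Finset.univ.map (xEmb m k)), fun w => ?_, ?_⟩
    · simp only [Finset.mem_insert, Finset.mem_map, Finset.mem_univ, xEmb_apply, true_and]
      rcases w with j | j | ⟨c, t⟩ <;> grind [Vertex.Adj, Attach]
    · rw [Finset.card_insert_of_notMem] <;> simp
  · refine ⟨insert (y ⟨i + 1, by omega⟩) (insert (y ⟨i - 1, by omega⟩)
      ((Finset.univ.erase i).map (xEmb m k))), fun w => ?_, ?_⟩
    · simp only [Finset.mem_insert, Finset.mem_map, Finset.mem_erase, Finset.mem_univ, xEmb_apply,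
        and_true]
      rcases w with j | j | ⟨c, t⟩ <;> grind [Vertex.Adj, Attach]
    · rw [Finset.card_insert_of_notMem, Finset.card_insert_of_notMem] <;> simp [Fin.ext_iff]
      omega

theorem ncard_neighborSet_fewGraph (v : Vertex m k) :
    ((fewGraph m k).neighborSet v).ncard = m + 3 := by
  obtain ⟨S, hS, hcard⟩ : ∃ S : Finset (Vertex m k), (∀ w, w ∈ S ↔ Vertex.Adj v w) ∧
      S.card = m + 3 := by
    rcases v with i | i | ⟨c, t⟩
    · exact exists_neighbors_x i
    · exact exists_neighbors_y i
    · exact exists_neighbors_unit c t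
  rw [← hcard, ← Set.ncard_coe_finset]
  congr 1
  ext w
  rw [Finset.mem_coe, hS, SimpleGraph.mem_neighborSet, fewGraph_adj]

end Regular

/-! ### Gluing paths into a hamiltonian cycle -/

section HasPath
variable {V : Type*} {G : SimpleGraph V}

/-- There is a path from `s` to `t` whose vertices are the elements of `S`. -/
def HasPath (G : SimpleGraph V) (S : Set V) (s t : V) : Prop :=
  ∃ p : G.Walk s t, p.IsPath ∧ ∀ v, v ∈ p.support ↔ v ∈ S

theorem HasPath.singleton (G : SimpleGraph V) (v : V) : HasPath G {v} v v :=
  ⟨.nil, by simp, by simp⟩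

theorem HasPath.append {S T U : Set V} {s t s' t' : V} (h : HasPath G S s t) (h' : HasPath G T s' t')
    (hadj : G.Adj t s') (hd : ∀ v ∈ S, v ∉ T) (hU : ∀ v, v ∈ U ↔ v ∈ S ∨ v ∈ T) :
    HasPath G U s t' := by
  obtain ⟨p, hp, hpS⟩ := h
  obtain ⟨q, hq, hqT⟩ := h'
  have hs : (p.append (.cons hadj q)).support = p.support ++ q.support := by
    rw [SimpleGraph.Walk.support_append, SimpleGraph.Walk.support_cons, List.tail_cons]
  refine ⟨p.append (.cons hadj q), ?_, fun v => ?_⟩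
  · rw [SimpleGraph.Walk.isPath_def, hs, List.nodup_append]
    refine ⟨hp.support_nodup, hq.support_nodup, ?_⟩
    rintro a ha b hb rfl
    exact hd a ((hpS a).1 ha) ((hqT a).1 hb)
  · rw [hs, List.mem_append, hpS, hqT, hU]

theorem HasPath.reverse {S : Set V} {s t : V} (h : HasPath G S s t) : HasPath G S t s := by
  obtain ⟨p, hp, hpS⟩ := h
  exact ⟨p.reverse, hp.reverse, by simpa using hpS⟩

theorem HasPath.hamiltonianCycles_nonempty [DecidableEq V] [Fintype V] {s t : V}
    (h : HasPath G Set.univ s t) (hadj : G.Adj t s) (hV : 3 ≤ Fintype.card V) :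
    (hamiltonianCycles G).Nonempty := by
  obtain ⟨p, hp, hpS⟩ := h
  have hH : p.IsHamiltonian := hp.isHamiltonian_of_mem (by simpa using hpS)
  have hlen := hH.length_eq
  refine ⟨_, t, .cons hadj p, ?_, rfl⟩
  rw [SimpleGraph.Walk.isHamiltonianCycle_iff_isCycle_and_length_eq,
    SimpleGraph.Walk.cons_isCycle_iff, SimpleGraph.Walk.length_cons]
  refine ⟨⟨hp, fun he => ?_⟩, by omega⟩
  -- If the closing edge lay on the path, `t` would be its second vertex and the path would have
  -- length 1, too short for three vertices.
  have h := hp.eq_snd_of_mem_edges (Sym2.eq_swap ▸ he)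
  rw [SimpleGraph.Walk.snd, eq_comm, hp.getVert_eq_end_iff (by omega)] at h
  omega

end HasPath

/-! ### Existence of a hamiltonian cycle -/

section Hamiltonian
variable {m k : ℕ}

/-- A set of vertices described by conditions on the indices in the three families. -/
def region (m k : ℕ) (P Q : ℕ → Prop) (R : ℕ → ℕ → Prop) : Set (Vertex m k) :=
  {v | match v with
    | x i => P i
    | y i => Q i
    | u c t => R c t}

variable {P Q : ℕ → Prop} {R : ℕ → ℕ → Prop}

@[simp] theorem x_mem_region {i : Fin (m + 2)} : x i ∈ region m k P Q R ↔ P i := Iff.rfl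

@[simp] theorem y_mem_region {i : Fin (m + 2)} : y i ∈ region m k P Q R ↔ Q i := Iff.rfl

@[simp] theorem u_mem_region {c : Fin (m + k + 1)} {t : Fin (m + 4)} :
    u c t ∈ region m k P Q R ↔ R c t := Iff.rfl

/-- The unit is traversed in index order; in a linked unit this stops before `m + 3`, since the last
two vertices are not adjacent. -/
theorem hasPath_unit (c j : ℕ) (hc : c < m + k + 1) (hj4 : j < m + 4)
    (hj : m ≤ c → c < m + k → j < m + 3) :
    HasPath (fewGraph m k) (region m k (fun _ => False) (fun _ => False)
      fun c' t => c' = c ∧ t ≤ j) (u ⟨c, hc⟩ 0) (u ⟨c, hc⟩ ⟨j, hj4⟩) := by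
  induction j with
  | zero =>
    convert HasPath.singleton _ _ using 1
    · ext v
      rcases v with i | i | ⟨c', t⟩ <;> simp
      grind
    · rfl
  | succ j ih =>
    refine (ih (by omega) (by omega)).append (HasPath.singleton _ (u ⟨c, hc⟩ ⟨j + 1, hj4⟩)) ?_ ?_ ?_
    · rw [fewGraph_adj]
      simp only [Vertex.Adj, Inside]
      grind
    · rintro (i | i | ⟨c', t⟩) <;> simp [Fin.ext_iff]; omega
    · rintro (i | i | ⟨c', t⟩) <;> simp [Fin.ext_iff]; omega

theorem hasPath_low (i : ℕ) (hi : i ≤ m) :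
    HasPath (fewGraph m k) (region m k (· ≤ i) (fun _ => False) fun c _ => c < i)
      (x 0) (x ⟨i, by omega⟩) := by
  induction i with
  | zero =>
    convert HasPath.singleton _ _ using 1
    · ext v
      rcases v with i | i | ⟨c', t⟩ <;> simp
    · rfl
  | succ i ih =>
    have h1 := (ih (by omega)).append (hasPath_unit i (m + 3) (by omega) (by omega) (by omega))
      (U := region m k (· ≤ i) (fun _ => False) fun c _ => c < i + 1)
      (by rw [fewGraph_adj]; simp [Vertex.Adj, Attach]; omega)
      (by rintro (i | i | ⟨c', t⟩) <;> simp; omega)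
      (by rintro (i | i | ⟨c', t⟩) <;> simp; omega)
    refine h1.append (HasPath.singleton _ (x ⟨i + 1, by omega⟩))
      (by rw [fewGraph_adj]; simp [Vertex.Adj, Attach]; omega)
      (by rintro (i | i | ⟨c', t⟩) <;> simp [Fin.ext_iff]; omega)
      (by rintro (i | i | ⟨c', t⟩) <;> simp [Fin.ext_iff]; omega)

/-- The path goes out along the chain through all but the last vertex of each linked unit, crosses
the final unit, and returns along the last vertices. -/
theorem hasPath_high (c j : ℕ) (hj : c + j = m + k) (hc : m ≤ c) :
    HasPath (fewGraph m k) (region m k (fun _ => False) (fun _ => False) fun c' _ => c ≤ c')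
      (u ⟨c, by omega⟩ 0) (u ⟨c, by omega⟩ (Fin.last _)) := by
  induction j generalizing c with
  | zero =>
    convert hasPath_unit (m := m) (k := k) c (m + 3) (by omega) (by omega) (by omega) using 1
    · ext v
      rcases v with i | i | ⟨c', t⟩ <;> simp
      omega
    · rfl
  | succ j ih =>
    have h1 := (hasPath_unit c (m + 2) (by omega) (by omega) (by omega)).append
      (ih (c + 1) (by omega) (by omega))
      (U := region m k (fun _ => False) (fun _ => False)
        fun c' t => c ≤ c' ∧ ¬ (c' = c ∧ t = m + 3))
      (by rw [fewGraph_adj]; simp [Vertex.Adj, Next]; omega)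
      (by rintro (i | i | ⟨c', t⟩) <;> simp; omega)
      (by rintro (i | i | ⟨c', t⟩) <;> simp; omega)
    refine h1.append (HasPath.singleton _ (u ⟨c, by omega⟩ (Fin.last _)))
      (by rw [fewGraph_adj]; simp [Vertex.Adj, Next]; omega)
      (by rintro (i | i | ⟨c', t⟩) <;> simp [Fin.ext_iff])
      (by rintro (i | i | ⟨c', t⟩) <;> simp [Fin.ext_iff]; omega)

theorem hasPath_y (j : ℕ) (hj : j < m + 2) :
    HasPath (fewGraph m k) (region m k (fun _ => False) (· ≤ j) fun _ _ => False)
      (y 0) (y ⟨j, hj⟩) := by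
  induction j with
  | zero =>
    convert HasPath.singleton _ _ using 1
    · ext v
      rcases v with i | i | ⟨c', t⟩ <;> simp
    · rfl
  | succ j ih =>
    exact (ih (by omega)).append (HasPath.singleton _ (y ⟨j + 1, hj⟩))
      (by rw [fewGraph_adj]; simp [Vertex.Adj])
      (by rintro (i | i | ⟨c', t⟩) <;> simp [Fin.ext_iff]; omega)
      (by rintro (i | i | ⟨c', t⟩) <;> simp [Fin.ext_iff]; omega)

theorem hamiltonianCycles_fewGraph_nonempty (m k : ℕ) :
    (hamiltonianCycles (fewGraph m k)).Nonempty := by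
  have h1 := (hasPath_low (m := m) (k := k) m le_rfl).append (hasPath_high m k rfl le_rfl)
    (U := region m k (· ≤ m) (fun _ => False) fun _ _ => True)
    (by rw [fewGraph_adj]; simp [Vertex.Adj, Attach])
    (by rintro (i | i | ⟨c', t⟩) <;> simp)
    (by rintro (i | i | ⟨c', t⟩) <;> simp; omega)
  have h2 := h1.append (HasPath.singleton _ (x (Fin.last _)))
    (U := region m k (fun _ => True) (fun _ => False) fun _ _ => True)
    (by rw [fewGraph_adj]; simp [Vertex.Adj, Attach])
    (by rintro (i | i | ⟨c', t⟩) <;> simp [Fin.ext_iff]; omega)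
    (by rintro (i | i | ⟨c', t⟩) <;> simp [Fin.ext_iff]; omega)
  have h3 := h2.append (hasPath_y (m + 1) (by omega)).reverse (U := Set.univ)
    (by rw [fewGraph_adj]; simp [Vertex.Adj])
    (by rintro (i | i | ⟨c', t⟩) <;> simp)
    (by rintro (i | i | ⟨c', t⟩) <;> simp; omega)
  refine h3.hamiltonianCycles_nonempty (by rw [fewGraph_adj]; simp [Vertex.Adj]) ?_
  rw [card_eq]
  nlinarith

end Hamiltonian

/-! ### Forced edges at the units -/

theorem eq_or_eq_of_mem_edges {V : Type*} [DecidableEq V] {G : SimpleGraph V} {r : V}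
    {p : G.Walk r r} (hp : p.IsHamiltonianCycle) {v a b w : V} (hab : a ≠ b)
    (ha : s(v, a) ∈ p.edges) (hb : s(v, b) ∈ p.edges) (hw : s(v, w) ∈ p.edges) :
    w = a ∨ w = b := by
  obtain ⟨a', b', -, h⟩ := exists_two_neighbors hp v
  rw [h] at ha hb hw
  grind

/-- `H` restricts only the edges of the cycle, so `A` may have further outgoing edges in `G`; the
blocks of linked units need this. -/
theorem inter_sym2_mem_pathFamily {V : Type*} [DecidableEq V] {G : SimpleGraph V} {r : V}
    {p : G.Walk r r} (hp : p.IsHamiltonianCycle) (A : Finset V)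
    {s s' t t' : V} (hs : s ∈ A) (ht : t ∈ A) (hst : s ≠ t) (hs' : s' ∉ A)
    (H : ∀ a ∈ A, ∀ b ∉ A, s(a, b) ∈ p.edges → a = s ∧ b = s' ∨ a = t ∧ b = t') :
    {e | e ∈ p.edges} ∩ (A.sym2 : Set (Sym2 V)) ∈ pathFamily A s t := by
  obtain ⟨-, -, l, hl, hA, hls, hlt, h⟩ :=
    exists_path_of_cut hp (A : Set V) (s := s) (s' := s') (t := t) (t' := t') hs ht hst hs' H
  convert pathEdges_mem_pathFamily hst hl hA hls hlt using 1
  ext e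
  induction e with
  | _ a b =>
    simp only [Set.mem_inter_iff, Set.mem_ofPred_eq, Finset.mem_coe, Finset.mk_mem_sym2_iff]
    constructor
    · rintro ⟨he, ha, hb⟩
      exact (h a ha b hb).1 he
    · intro he
      have : a ∈ A ∧ b ∈ A := by
        rw [mk_mem_pathEdges] at he
        have hA' : ∀ v, v ∈ l → v ∈ A := fun v hv => (hA v).1 hv
        rcases he with he | he <;> have := mem_of_pair_infix he
        · exact ⟨hA' _ this.1, hA' _ this.2⟩
        · exact ⟨hA' _ this.2, hA' _ this.1⟩
      exact ⟨(h a this.1 b this.2).2 he, this⟩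

section
variable {m k : ℕ} {r : Vertex m k} {p : (fewGraph m k).Walk r r}

theorem adj_of_mem_edges {v w : Vertex m k} (h : s(v, w) ∈ p.edges) : Vertex.Adj v w :=
  p.adj_of_mem_edges h

/-- The cut set is unit `c` alone when `c < m`, and the whole rest of the chain from unit `c` on
when `m ≤ c`. -/
theorem entry_leave_mem_edges (hp : p.IsHamiltonianCycle) (c : Fin (m + k + 1)) :
    s(u c 0, entry c) ∈ p.edges ∧ s(u c (Fin.last _), leave c) ∈ p.edges := by
  have h := exists_path_of_cut hp (region m k (fun _ => False) (fun _ => False)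
    fun c' _ => c' = c ∨ (m ≤ c ∧ c ≤ c')) (s := u c 0) (s' := entry c) (t := u c (Fin.last _))
    (t' := leave c) (by simp) (by simp) (by simp [Fin.ext_iff])
    (by
      rw [entry]
      split_ifs with h
      exacts [id, fun h' => by rw [u_mem_region] at h'; dsimp only at h'; omega]) ?_
  · exact ⟨h.1, h.2.1⟩
  · intro a ha b hb hab
    have hadj := adj_of_mem_edges hab
    rcases a with i | i | ⟨c', t⟩
    · exact absurd ha (by simp)
    · exact absurd ha (by simp)
    · rw [u_mem_region] at ha
      rcases b with i | i | ⟨c'', t'⟩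
      · simp only [Vertex.Adj, Attach] at hadj
        simp only [entry, leave]
        grind
      · exact absurd hadj (by simp [Vertex.Adj])
      · rw [u_mem_region] at hb
        simp only [Vertex.Adj, Next] at hadj
        simp only [entry, leave]
        grind

theorem attach_mem_edges (hp : p.IsHamiltonianCycle) {i : Fin (m + 2)} {c : Fin (m + k + 1)}
    {t : Fin (m + 4)} (h : Attach m i c t) : s(x i, u c t) ∈ p.edges := by
  obtain ⟨h1, h2⟩ := entry_leave_mem_edges hp c
  obtain ⟨hc, ⟨ht, hi⟩ | ⟨ht, hi⟩⟩ := h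
  · obtain rfl : t = 0 := by ext; simpa using ht
    rw [Sym2.eq_swap]
    rw [entry, dif_pos hc] at h1
    rw [show i = ⟨c, by omega⟩ from Fin.ext hi.symm]
    exact h1
  · obtain rfl : t = Fin.last _ := by ext; simpa using ht
    rw [Sym2.eq_swap]
    rw [leave, dif_pos hc] at h2
    rw [show i = ⟨c + 1, by omega⟩ from Fin.ext hi.symm]
    exact h2

theorem next_mem_edges (hp : p.IsHamiltonianCycle) {c c' : Fin (m + k + 1)}
    {t t' : Fin (m + 4)} (h : Next m c t c' t') : s(u c t, u c' t') ∈ p.edges := by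
  obtain ⟨h1, h2⟩ := entry_leave_mem_edges hp c'
  obtain ⟨hc, hcc, ⟨ht, hi⟩ | ⟨ht, hi⟩⟩ := h
  · obtain rfl : t' = 0 := by ext; simpa using hi
    rw [Sym2.eq_swap]
    rw [entry, dif_neg (by omega)] at h1
    rw [show t = ⟨m + 2, (by omega : m + 2 < m + 4)⟩ from Fin.ext ht]
    rw [show c = ⟨c' - 1, by omega⟩ from Fin.ext (by simp; omega)]
    exact h1
  · obtain rfl : t' = Fin.last _ := by ext; simpa using hi
    rw [Sym2.eq_swap]
    rw [leave, dif_neg (by omega)] at h2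
    rw [show c = ⟨c' - 1, by omega⟩ from Fin.ext (by simp; omega)]
    obtain rfl : t = Fin.last _ := Fin.ext ht
    exact h2

/-- In the units that are linked to a following unit, the last vertex has no neighbour of its own
unit on a hamiltonian cycle. -/
theorem last_not_mem_edges (hp : p.IsHamiltonianCycle) {c : Fin (m + k + 1)} (hc : m ≤ c.val)
    (hc' : c.val < m + k) (t : Fin (m + 4)) : s(u c (Fin.last _), u c t) ∉ p.edges := by
  intro h
  have h1 := (entry_leave_mem_edges hp c).2
  have h2 : s(u c (Fin.last _), u ⟨c + 1, by omega⟩ (Fin.last _)) ∈ p.edges :=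
    next_mem_edges hp ⟨hc, rfl, Or.inr (by simp)⟩
  have hne : leave c ≠ u ⟨c + 1, by omega⟩ (Fin.last _) := by
    rw [leave]
    split_ifs <;> simp [Fin.ext_iff]
  rcases eq_or_eq_of_mem_edges hp hne h1 h2 h with h | h
  · exact leave_ne c t h.symm
  · simp [Fin.ext_iff] at h

/-- The part of unit `c` through which a hamiltonian cycle runs as a path. -/
def block (c : Fin (m + k + 1)) : Finset (Vertex m k) :=
  (Finset.univ.filter fun t : Fin (m + 4) =>
    m ≤ c.val → c.val < m + k → t ≠ Fin.last _).map (uEmb c)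

/-- The second end of the path through `block c`. -/
def blockEnd (c : Fin (m + k + 1)) : Vertex m k :=
  if m ≤ c.val ∧ c.val < m + k then u c ⟨m + 2, by omega⟩ else u c (Fin.last _)

theorem mem_block {c : Fin (m + k + 1)} {v : Vertex m k} :
    v ∈ block c ↔ ∃ t, v = u c t ∧ (m ≤ c.val → c.val < m + k → t ≠ Fin.last _) := by
  simp only [block, Finset.mem_map, Finset.mem_filter, Finset.mem_univ, true_and, uEmb_apply]
  grind

theorem card_block (c : Fin (m + k + 1)) :
    (block c).card = if m ≤ c.val ∧ c.val < m + k then m + 3 else m + 4 := by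
  rw [block, Finset.card_map]
  split_ifs with h
  · have : (Finset.univ.filter fun t : Fin (m + 4) =>
        m ≤ c.val → c.val < m + k → t ≠ Fin.last _) = Finset.univ.erase (Fin.last _) := by
      ext t; simp [h.1, h.2]
    rw [this, Finset.card_erase_of_mem (Finset.mem_univ _), Finset.card_univ, Fintype.card_fin]
    rfl
  · rw [Finset.filter_true_of_mem (by grind), Finset.card_univ, Fintype.card_fin]

theorem zero_mem_block (c : Fin (m + k + 1)) : u c 0 ∈ block c :=
  mem_block.2 ⟨0, rfl, by simp [Fin.ext_iff]⟩

theorem blockEnd_mem_block (c : Fin (m + k + 1)) : blockEnd c ∈ block c := by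
  rw [mem_block, blockEnd]
  split_ifs with h
  · exact ⟨_, rfl, by simp [Fin.ext_iff]⟩
  · exact ⟨_, rfl, by grind⟩

theorem zero_ne_blockEnd (c : Fin (m + k + 1)) : u c 0 ≠ blockEnd c := by
  rw [blockEnd]
  split_ifs with h <;> simp [Fin.ext_iff]

theorem inter_block_mem_pathFamily (hp : p.IsHamiltonianCycle) (c : Fin (m + k + 1)) :
    {e | e ∈ p.edges} ∩ ((block c).sym2 : Set (Sym2 (Vertex m k))) ∈
      pathFamily (block c) (u c 0) (blockEnd c) := by
  refine inter_sym2_mem_pathFamily hp (block c) (s' := entry c)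
    (t' := if h : m ≤ c.val ∧ c.val < m + k then u ⟨c + 1, by omega⟩ 0 else leave c)
    (zero_mem_block c) (blockEnd_mem_block c) (zero_ne_blockEnd c) ?_ ?_
  · rw [mem_block]
    rintro ⟨t, h, -⟩
    exact entry_ne c t h
  · intro a ha b hb hab
    obtain ⟨t, rfl, ht⟩ := mem_block.1 ha
    have hadj := adj_of_mem_edges hab
    -- In a linked unit the graph has edges from the block to the removed last vertex, but the cycle
    -- uses none of them.
    have hl := last_not_mem_edges hp (c := c)
    rw [Sym2.eq_swap] at hab
    rw [mem_block] at hb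
    by_cases ht0 : t = 0
    · subst ht0
      rw [adj_zero] at hadj
      left
      grind
    rw [blockEnd]
    by_cases hc : m ≤ c.val ∧ c.val < m + k
    · rw [if_pos hc, dif_pos hc]
      rw [adj_middle ht0 (ht hc.1 hc.2)] at hadj
      rcases hadj with ⟨c', h2, -, h, rfl⟩ | ⟨t', rfl, -, -⟩
      · refine Or.inr ⟨?_, ?_⟩ <;> congr 1 <;> ext
        exacts [h2, h]
      · have : t' = Fin.last _ := by grind
        exact absurd hab (this ▸ hl hc.1 hc.2 t)
    · rw [if_neg hc, dif_neg hc]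
      by_cases htl : t = Fin.last _
      · subst htl
        rw [adj_last] at hadj
        grind
      · rw [adj_middle ht0 htl] at hadj
        grind

end

/-! ### Forced edges at the two families -/

section
variable {m k : ℕ} {r : Vertex m k} {p : (fewGraph m k).Walk r r}

theorem exists_other_neighbor {V : Type*} [DecidableEq V] {G : SimpleGraph V} {r : V}
    {p : G.Walk r r} (hp : p.IsHamiltonianCycle) {v a : V} (ha : s(v, a) ∈ p.edges) :
    ∃ b, b ≠ a ∧ s(v, b) ∈ p.edges := by
  obtain ⟨a', b', hab, h⟩ := exists_two_neighbors hp v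
  rcases (h a).1 ha with rfl | rfl
  · exact ⟨b', hab.symm, (h b').2 (Or.inr rfl)⟩
  · exact ⟨a', hab, (h a').2 (Or.inl rfl)⟩

theorem x_y_not_mem_edges (hp : p.IsHamiltonianCycle) {i : Fin (m + 2)} (h0 : i.val ≠ 0)
    (hl : i.val ≠ m + 1) (j : Fin (m + 2)) : s(x i, y j) ∉ p.edges := by
  intro h
  have h1 : s(x i, u ⟨i, by omega⟩ 0) ∈ p.edges :=
    attach_mem_edges hp ⟨by dsimp only; omega, Or.inl ⟨rfl, rfl⟩⟩
  have h2 : s(x i, u ⟨i - 1, by omega⟩ (Fin.last _)) ∈ p.edges :=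
    attach_mem_edges hp ⟨by dsimp only; omega, Or.inr ⟨rfl, by dsimp only; omega⟩⟩
  rcases eq_or_eq_of_mem_edges hp (by simp [Fin.ext_iff]) h1 h2 h with h | h <;> simp at h

/-- An `x i` attached to only one unit vertex, as at the two ends of the family, must take its other
cycle edge to some `y j`. -/
theorem exists_y_of_attach (hp : p.IsHamiltonianCycle) {i : Fin (m + 2)} {c : Fin (m + k + 1)}
    {t : Fin (m + 4)} (h : Attach m i c t)
    (huniq : ∀ (c' : Fin (m + k + 1)) (t' : Fin (m + 4)), Attach m i c' t' → c' = c ∧ t' = t) :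
    ∃ j, ∀ j', s(x i, y j') ∈ p.edges ↔ j' = j := by
  have h1 : s(x i, u c t) ∈ p.edges := attach_mem_edges hp h
  obtain ⟨w, hw, h2⟩ := exists_other_neighbor hp h1
  have hadj := adj_of_mem_edges h2
  rcases w with i' | j | ⟨c', t'⟩
  · exact absurd hadj (by simp [Vertex.Adj])
  · refine ⟨j, fun j' => ⟨fun h => ?_, fun h => h ▸ h2⟩⟩
    rcases eq_or_eq_of_mem_edges hp hw h2 h1 h with h | h
    · simpa using h
    · simp at h
  · obtain ⟨rfl, rfl⟩ := huniq c' t' hadj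
    exact absurd rfl hw

/-- On a hamiltonian cycle the end vertices of the family `x` are matched to the end vertices of the
family `y`, and there are no other edges between the two families. -/
theorem x_y_mem_edges (hp : p.IsHamiltonianCycle) :
    (∀ i j, s(x i, y j) ∈ p.edges ↔ i = 0 ∧ j = 0 ∨ i = Fin.last _ ∧ j = Fin.last _) ∨
      (∀ i j, s(x i, y j) ∈ p.edges ↔ i = 0 ∧ j = Fin.last _ ∨ i = Fin.last _ ∧ j = 0) := by
  obtain ⟨a, ha⟩ := exists_y_of_attach hp (i := 0) (c := 0) (t := 0) (by simp [Attach])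
    (by simp only [Attach]; grind)
  obtain ⟨b, hb⟩ := exists_y_of_attach hp (i := Fin.last _) (c := ⟨m, by omega⟩) (t := Fin.last _)
    (by simp [Attach]) (by simp only [Attach]; grind)
  have hxy : ∀ i j, s(x i, y j) ∈ p.edges ↔ i = 0 ∧ j = a ∨ i = Fin.last _ ∧ j = b := by
    intro i j
    by_cases h0 : i = 0
    · subst h0
      rw [ha]
      simp [Fin.ext_iff]
    by_cases hl : i = Fin.last _
    · subst hl
      rw [hb]
      simp [Fin.ext_iff]
    · have := x_y_not_mem_edges hp (i := i) (fun h => h0 (Fin.ext h)) (fun h => hl (Fin.ext h)) j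
      simp [this, h0, hl]
  -- An end of the path on `y` has a single neighbour in `y`, so it needs a cycle edge to `x`, and
  -- only `a` and `b` receive one. Hence `a` and `b` are the two ends.
  have hend : ∀ j : Fin (m + 2), j.val = 0 ∨ j.val = m + 1 → j = a ∨ j = b := by
    intro j hj
    obtain ⟨v, w, hvw, h⟩ := exists_two_neighbors hp (y j)
    by_contra! hne
    have hy : ∀ w, s(y j, w) ∈ p.edges → ∃ i : Fin (m + 2), w = y i ∧
        (j.val + 1 = i.val ∨ i.val + 1 = j.val) := by
      intro w hw
      have hadj := adj_of_mem_edges hw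
      rcases w with i | i | ⟨c, t⟩
      · rw [Sym2.eq_swap, hxy] at hw
        grind
      · exact ⟨i, rfl, hadj⟩
      · exact absurd hadj (by simp [Vertex.Adj])
    obtain ⟨i, rfl, hi⟩ := hy v ((h v).2 (Or.inl rfl))
    obtain ⟨i', rfl, hi'⟩ := hy w ((h w).2 (Or.inr rfl))
    apply hvw
    congr 1
    ext
    omega
  have h1 := hend 0 (by simp)
  have h2 := hend (Fin.last _) (by simp)
  have h3 : (0 : Fin (m + 2)) ≠ Fin.last _ := by simp [Fin.ext_iff]
  simp only [hxy]
  grind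

/-- Apart from `y j`, only one vertex `z` can be a cycle neighbour of `y i`: the matched end of `x`
if `i = 0`, and the preceding `y` otherwise. -/
theorem y_y_mem_edges (hp : p.IsHamiltonianCycle) {i j : Fin (m + 2)} (hij : i.val + 1 = j.val) :
    s(y i, y j) ∈ p.edges := by
  obtain ⟨z, hz⟩ : ∃ z, ∀ w, s(y i, w) ∈ p.edges → w = y j ∨ w = z := by
    have hxy := x_y_mem_edges hp
    have h3 : (0 : Fin (m + 2)) ≠ Fin.last _ := by simp [Fin.ext_iff]
    by_cases h0 : i = 0
    · obtain ⟨z, hz⟩ : ∃ z, ∀ i', s(x i', y i) ∈ p.edges → i' = z := by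
        rcases hxy with h | h
        · exact ⟨0, fun i' hi' => by rw [h] at hi'; grind⟩
        · exact ⟨Fin.last _, fun i' hi' => by rw [h] at hi'; grind⟩
      refine ⟨x z, fun w hw => ?_⟩
      have hadj := adj_of_mem_edges hw
      rcases w with i' | i' | ⟨c, t⟩
      · rw [Sym2.eq_swap] at hw
        exact Or.inr (by rw [hz i' hw])
      · left
        simp only [Vertex.Adj] at hadj
        congr 1
        ext
        have : i.val = 0 := by simp [h0]
        omega
      · exact absurd hadj (by simp [Vertex.Adj])
    · refine ⟨y ⟨i - 1, by omega⟩, fun w hw => ?_⟩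
      have hadj := adj_of_mem_edges hw
      rcases w with i' | i' | ⟨c, t⟩
      · rw [Sym2.eq_swap] at hw
        grind
      · simp only [Vertex.Adj] at hadj
        simp only [y.injEq, Fin.ext_iff]
        omega
      · exact absurd hadj (by simp [Vertex.Adj])
  obtain ⟨v, w, hvw, h⟩ := exists_two_neighbors hp (y i)
  have hv := (h v).2 (Or.inl rfl)
  have hw := (h w).2 (Or.inr rfl)
  rcases hz v hv with rfl | hv'
  · exact hv
  · rcases hz w hw with rfl | hw'
    · exact hw
    · exact absurd (hv'.trans hw'.symm) hvw

theorem mem_block_of_inside (hp : p.IsHamiltonianCycle) {c : Fin (m + k + 1)}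
    {t t' : Fin (m + 4)} (h : s(u c t, u c t') ∈ p.edges) :
    u c t ∈ block c ∧ u c t' ∈ block c := by
  have hl := last_not_mem_edges hp (c := c)
  have h' := h
  rw [Sym2.eq_swap] at h'
  rw [mem_block, mem_block]
  refine ⟨⟨t, rfl, ?_⟩, t', rfl, ?_⟩
  · rintro h1 h2 rfl
    exact hl h1 h2 t' h
  · rintro h1 h2 rfl
    exact hl h1 h2 t h'

/-- A hamiltonian cycle is determined by its paths through the blocks and by whether it uses the
edge between the first vertices of the families `x` and `y`. -/
theorem edges_subset_of_agree {r' : Vertex m k} {q : (fewGraph m k).Walk r' r'}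
    (hp : p.IsHamiltonianCycle) (hq : q.IsHamiltonianCycle)
    (h0 : s(x 0, y 0) ∈ p.edges ↔ s(x 0, y 0) ∈ q.edges)
    (hblock : ∀ c : Fin (m + k + 1), {e | e ∈ p.edges} ∩ ((block c).sym2 : Set (Sym2 (Vertex m k))) =
      {e | e ∈ q.edges} ∩ ((block c).sym2 : Set (Sym2 (Vertex m k)))) :
    {e | e ∈ p.edges} ⊆ {e | e ∈ q.edges} := by
  have hxy : ∀ i j, s(x i, y j) ∈ p.edges → s(x i, y j) ∈ q.edges := by
    intro i j
    have h3 : (0 : Fin (m + 2)) ≠ Fin.last _ := by simp [Fin.ext_iff]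
    rcases x_y_mem_edges hp with hP | hP <;> rcases x_y_mem_edges hq with hQ | hQ <;>
      rw [hP, hQ] at h0 <;> rw [hP, hQ] <;> grind
  intro e he
  induction e with
  | _ a b =>
    simp only [Set.mem_ofPred_eq] at he ⊢
    have hadj := adj_of_mem_edges he
    rcases a with i | i | ⟨c, t⟩ <;> rcases b with j | j | ⟨c', t'⟩
    · exact absurd hadj (by simp [Vertex.Adj])
    · exact hxy i j he
    · exact attach_mem_edges hq hadj
    · rw [Sym2.eq_swap] at he ⊢
      exact hxy j i he
    · rcases hadj with h | h
      · exact y_y_mem_edges hq h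
      · rw [Sym2.eq_swap]
        exact y_y_mem_edges hq h
    · exact absurd hadj (by simp [Vertex.Adj])
    · rw [Sym2.eq_swap]
      exact attach_mem_edges hq hadj
    · exact absurd hadj (by simp [Vertex.Adj])
    · rcases hadj with ⟨rfl, -⟩ | h | h
      · have hmem : s(u c t, u c t') ∈ {e | e ∈ p.edges} ∩
            ((block c).sym2 : Set (Sym2 (Vertex m k))) :=
          ⟨he, Finset.mem_coe.2 (Finset.mk_mem_sym2_iff.2 (mem_block_of_inside hp he))⟩
        rw [hblock c] at hmem
        exact hmem.1
      · exact next_mem_edges hq h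
      · rw [Sym2.eq_swap]
        exact next_mem_edges hq h

end

/-! ### Counting the hamiltonian cycles -/

theorem encard_hamiltonianCycles_fewGraph_le (m k : ℕ) :
    (hamiltonianCycles (fewGraph m k)).encard ≤
      ((2 * (m + 2)! ^ (m + 1) * (m + 1)! ^ k : ℕ) : ℕ∞) := by
  classical
  set T : Finset (Prop × (Fin (m + k + 1) → Set (Sym2 (Vertex m k)))) :=
    Finset.univ ×ˢ Fintype.piFinset fun c => pathFamily (block c) (u c 0) (blockEnd c) with hT
  set Φ : Set (Sym2 (Vertex m k)) → Prop × (Fin (m + k + 1) → Set (Sym2 (Vertex m k))) :=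
    fun E => (s(x 0, y 0) ∈ E, fun c => E ∩ ((block c).sym2 : Set (Sym2 (Vertex m k)))) with hΦ
  have hmaps : Set.MapsTo Φ (hamiltonianCycles (fewGraph m k)) (T : Set _) := by
    rintro E ⟨r, p, hp, rfl⟩
    simp only [hT, hΦ, Finset.coe_product, Set.mem_prod, Finset.coe_univ, Set.mem_univ, true_and,
      Finset.mem_coe, Fintype.mem_piFinset]
    exact inter_block_mem_pathFamily hp
  have hinj : Set.InjOn Φ (hamiltonianCycles (fewGraph m k)) := by
    rintro E ⟨r, p, hp, rfl⟩ E' ⟨r', q, hq, rfl⟩ h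
    simp only [hΦ, Prod.mk.injEq, funext_iff, Set.mem_ofPred_eq, eq_iff_iff] at h
    exact Set.Subset.antisymm (edges_subset_of_agree hp hq h.1 h.2)
      (edges_subset_of_agree hq hp h.1.symm fun c => (h.2 c).symm)
  refine (Set.encard_le_encard_of_injOn hmaps hinj).trans ?_
  rw [Set.encard_coe_eq_coe_finsetCard, Nat.cast_le, hT, Finset.card_product, Finset.card_univ,
    Fintype.card_prop, Fintype.card_piFinset, mul_assoc]
  -- The factor 2 is the number of truth values of `s(x 0, y 0) ∈ E`.
  refine Nat.mul_le_mul_left 2 ?_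
  calc ∏ c : Fin (m + k + 1), (pathFamily (block c) (u c 0) (blockEnd c)).card
      ≤ ∏ c : Fin (m + k + 1), if m ≤ c.val ∧ c.val < m + k then (m + 1)! else (m + 2)! := by
        refine Finset.prod_le_prod' fun c _ => ?_
        refine (card_pathFamily_le (zero_mem_block c) (blockEnd_mem_block c)
          (zero_ne_blockEnd c)).trans ?_
        rw [card_block]
        split_ifs <;> exact le_rfl
    _ = (m + 2)! ^ (m + 1) * (m + 1)! ^ k := by
        -- The product splits into units `0, …, m - 1`, the `k` linked units, and the final unit `m
        -- + k`, which supplies one more factor `(m + 2)!`.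
        rw [Fin.prod_univ_eq_prod_range
          (fun c => if m ≤ c ∧ c < m + k then (m + 1)! else (m + 2)!) (m + k + 1),
          Finset.prod_range_succ, Finset.prod_range_add, if_neg (by omega),
          Finset.prod_congr rfl fun c hc => if_neg (by rw [Finset.mem_range] at hc; omega),
          Finset.prod_congr rfl fun c hc => if_pos (by rw [Finset.mem_range] at hc; omega)]
        simp only [Finset.prod_const, Finset.card_range]
        ring

/-! ### Transfer to the vertex set `Fin n` -/

section Transfer
variable {V W : Type*} [DecidableEq V] [DecidableEq W] {G : SimpleGraph V} {H : SimpleGraph W}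

theorem hamiltonianCycles_nonempty_of_iso (ψ : G ≃g H) (h : (hamiltonianCycles G).Nonempty) :
    (hamiltonianCycles H).Nonempty := by
  obtain ⟨_, a, p, hp, -⟩ := h
  exact ⟨_, _, p.map ψ.toHom, hp.map ψ.bijective, rfl⟩

theorem encard_hamiltonianCycles_le_of_iso (ψ : G ≃g H) :
    (hamiltonianCycles H).encard ≤ (hamiltonianCycles G).encard := by
  refine (Set.encard_le_encard ?_).trans
    (Set.encard_image_le (Set.image (Sym2.map ψ)) (hamiltonianCycles G))
  rintro E ⟨a, p, hp, rfl⟩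
  refine ⟨_, ⟨_, p.map ψ.symm.toHom, hp.map ψ.symm.bijective, rfl⟩, ?_⟩
  have hid : ∀ e, Sym2.map ψ (Sym2.map ψ.symm.toHom e) = e := by
    intro e
    induction e with
    | _ v w => exact Sym2.eq_iff.2 (Or.inl ⟨ψ.apply_symm_apply v, ψ.apply_symm_apply w⟩)
  ext e
  simp only [SimpleGraph.Walk.edges_map, Set.mem_image, Set.mem_ofPred_eq, List.mem_map]
  constructor
  · rintro ⟨_, ⟨e', he', rfl⟩, rfl⟩
    rwa [hid]
  · exact fun he => ⟨_, ⟨e, he, rfl⟩, hid e⟩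

end Transfer

/-- A hamiltonian `(m + 3)`-regular graph with few hamiltonian cycles. -/
theorem exists_isHamiltonianRegular (m k : ℕ) :
    ∃ G : SimpleGraph (Fin (2 * (m + 2) + (m + k + 1) * (m + 4))), IsHamiltonianRegular G (m + 3) ∧
      (hamiltonianCycles G).encard ≤ ((2 * (m + 2)! ^ (m + 1) * (m + 1)! ^ k : ℕ) : ℕ∞) := by
  classical
  let e : Vertex m k ≃ Fin (2 * (m + 2) + (m + k + 1) * (m + 4)) :=
    Fintype.equivFinOfCardEq Vertex.card_eq
  let G := (fewGraph m k).comap e.symm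
  let ψ : fewGraph m k ≃g G := ⟨e, by simp [G]⟩
  refine ⟨G, ⟨fun v => ?_, ?_⟩, ?_⟩
  · have h : G.neighborSet v = e.symm ⁻¹' (fewGraph m k).neighborSet (e.symm v) := rfl
    have h' : (G.neighborSet v).ncard = m + 3 := by
      rw [h, ← e.image_eq_preimage_symm, Set.ncard_image_of_injective _ e.injective,
        ncard_neighborSet_fewGraph]
    rw [← SimpleGraph.card_neighborSet_eq_degree, ← h', ← Nat.card_coe_set_eq,
      Nat.card_eq_fintype_card]
    exact Fintype.card_congr (Equiv.refl _)
  · convert hamiltonianCycles_nonempty_of_iso ψ (hamiltonianCycles_fewGraph_nonempty m k)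
  · convert (encard_hamiltonianCycles_le_of_iso ψ).trans (encard_hamiltonianCycles_fewGraph_le m k)

/-! ### Comparison with the conjectured bound -/

section Inequality

/-- For `m ≥ 6`, `(1 + 1/(m+2))^(2m) ≤ e^2 < 8 ≤ m + 2`. This drives the induction in
`four_mul_pow_lt_factorial_pow`. -/
theorem pow_succ_le_pow (m : ℕ) (hm : 4 ≤ m) : (m + 3) ^ (2 * m) ≤ (m + 2) ^ (2 * m + 1) := by
  by_cases h : 6 ≤ m
  · have hm2 : (0 : ℝ) < m + 2 := by positivity
    have hm6 : (6 : ℝ) ≤ m := by exact_mod_cast h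
    have h1 : ((m : ℝ) + 3) / (m + 2) ≤ Real.exp (1 / (m + 2)) := by
      have := Real.add_one_le_exp (1 / ((m : ℝ) + 2))
      refine le_trans (le_of_eq ?_) this
      field_simp
      ring
    have h2 : (((m : ℝ) + 3) / (m + 2)) ^ (2 * m) ≤ m + 2 := by
      calc (((m : ℝ) + 3) / (m + 2)) ^ (2 * m)
          ≤ Real.exp (1 / (m + 2)) ^ (2 * m) := pow_le_pow_left₀ (by positivity) h1 _
        _ = Real.exp ((2 * m : ℕ) * (1 / (m + 2))) := (Real.exp_nat_mul _ _).symm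
        _ ≤ Real.exp 2 := by
            rw [Real.exp_le_exp, mul_one_div, div_le_iff₀ hm2]
            push_cast
            linarith
        _ = Real.exp 1 ^ 2 := by rw [← Real.exp_nat_mul]; norm_num
        _ ≤ 2.7182818286 ^ 2 := pow_le_pow_left₀ (Real.exp_pos 1).le Real.exp_one_lt_d9.le _
        _ ≤ m + 2 := by norm_num; linarith
    rw [div_pow, div_le_iff₀ (by positivity)] at h2
    have h3 : ((m : ℝ) + 3) ^ (2 * m) ≤ ((m : ℝ) + 2) ^ (2 * m + 1) := by rwa [pow_succ']
    exact_mod_cast h3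
  · interval_cases m <;> norm_num

theorem four_mul_pow_lt_factorial_pow (m : ℕ) (hm : 4 ≤ m) :
    4 * (m + 2) ^ (2 * (m - 1)) < (m + 1)! ^ 3 := by
  induction m, hm using Nat.le_induction with
  | base => decide
  | succ m hm ih =>
    rw [Nat.add_sub_cancel, Nat.factorial_succ, mul_pow]
    calc 4 * (m + 1 + 2) ^ (2 * m) ≤ 4 * (m + 2) ^ (2 * m + 1) :=
          Nat.mul_le_mul_left 4 (pow_succ_le_pow m hm)
      _ = (m + 2) ^ 3 * (4 * (m + 2) ^ (2 * (m - 1))) := by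
          obtain ⟨j, rfl⟩ : ∃ j, m = j + 1 := ⟨m - 1, by omega⟩
          rw [Nat.add_sub_cancel]
          ring
      _ < (m + 1 + 1) ^ 3 * (m + 1)! ^ 3 := Nat.mul_lt_mul_of_pos_left ih (by positivity)

theorem pow_lt_factorial_pow (m : ℕ) (hm : 2 ≤ m) :
    (2 * (m + 2) ^ (m - 1)) ^ (m + 4) < (m + 1)! ^ (2 * (m + 2)) := by
  by_cases h : 4 ≤ m
  · refine lt_of_pow_lt_pow_left₀ 2 (by positivity) ?_
    calc ((2 * (m + 2) ^ (m - 1)) ^ (m + 4)) ^ 2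
        = (4 * (m + 2) ^ (2 * (m - 1))) ^ (m + 4) := by
          rw [← pow_mul, mul_comm (m + 4), pow_mul, mul_pow, ← pow_mul, mul_comm (m - 1)]
          norm_num
      _ < ((m + 1)! ^ 3) ^ (m + 4) :=
          Nat.pow_lt_pow_left (four_mul_pow_lt_factorial_pow m h) (by omega)
      _ ≤ ((m + 1)! ^ (2 * (m + 2))) ^ 2 := by
          rw [← pow_mul, ← pow_mul]
          -- The exponents satisfy `3(m + 4) ≤ 4(m + 2)` exactly when `m ≥ 4`.
          exact Nat.pow_le_pow_right (Nat.factorial_pos _) (by omega)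
  · interval_cases m <;> decide

theorem lt_haythorpeBound (m k : ℕ) (hm : 2 ≤ m) :
    ((2 * (m + 2)! ^ (m + 1) * (m + 1)! ^ k : ℕ) : ℝ) <
      haythorpeBound (2 * (m + 2) + (m + k + 1) * (m + 4)) (m + 3) := by
  have hF : (0 : ℝ) < ((m + 1)! : ℕ) := by exact_mod_cast Nat.factorial_pos _
  have hm4 : (0 : ℝ) < m + 4 := by positivity
  set F : ℝ := (((m + 1)! : ℕ) : ℝ) with hFdef
  -- `X` is the contribution of the `2(m + 2)` vertices outside the units to the exponent `n/(d +
  -- 1)`; the units contribute `m + k + 1`.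
  set X : ℝ := F ^ ((2 * ((m : ℝ) + 2)) / (m + 4)) with hX
  have hXpow : X ^ (m + 4) = F ^ (2 * (m + 2)) := by
    rw [hX, ← Real.rpow_natCast, ← Real.rpow_mul hF.le, ← Real.rpow_natCast]
    congr 1
    push_cast
    field_simp
  have hlt : 2 * ((m : ℝ) + 2) ^ (m - 1) < X := by
    refine lt_of_pow_lt_pow_left₀ (m + 4) (Real.rpow_nonneg hF.le _) ?_
    rw [hXpow, hFdef]
    exact_mod_cast pow_lt_factorial_pow m hm
  have hexp : ((2 * (m + 2) + (m + k + 1) * (m + 4) : ℕ) : ℝ) / (((m + 3 : ℕ) : ℝ) + 1) =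
      ((m + 1 + k : ℕ) : ℝ) + (2 * ((m : ℝ) + 2)) / (m + 4) := by
    push_cast
    rw [show (m : ℝ) + 3 + 1 = m + 4 by ring]
    field_simp
    ring
  rw [haythorpeBound, show m + 3 - 2 = m + 1 by omega, hexp, Real.rpow_add hF, Real.rpow_natCast,
    ← hX]
  obtain ⟨j, rfl⟩ : ∃ j, m = j + 1 := ⟨m - 1, by omega⟩
  rw [Nat.add_sub_cancel] at hlt
  rw [Nat.factorial_succ (j + 1 + 1)]
  calc ((2 * ((j + 1 + 1 + 1) * (j + 1 + 1)!) ^ (j + 1 + 1) * (j + 1 + 1)! ^ k : ℕ) : ℝ)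
      = (((j + 1 : ℕ) : ℝ) + 2) ^ 2 * F ^ (j + 1 + 1 + k) *
          (2 * (((j + 1 : ℕ) : ℝ) + 2) ^ j) := by
        rw [hFdef, mul_pow]
        push_cast
        ring
    _ < (((j + 1 : ℕ) : ℝ) + 2) ^ 2 * F ^ (j + 1 + 1 + k) * X :=
        mul_lt_mul_of_pos_left hlt (by positivity)
    _ = _ := by
        push_cast
        ring

end Inequality

end FewHamiltonianCycles

/-! ### The main theorem -/

open FewHamiltonianCycles in
theorem mainTheorem1 (d : ℕ) (hd : 5 ≤ d) :
    (∀ k n : ℕ, n = d ^ 2 + d - 4 + (d + 1) * k →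
      minHamiltonianCycles n d ≤ ((2 * (d - 1)! ^ (d - 2) * (d - 2)! ^ k : ℕ) : ℕ∞) ∧
      ((2 * (d - 1)! ^ (d - 2) * (d - 2)! ^ k : ℕ) : ℝ) < haythorpeBound n d) ∧
    ¬ HaythorpeConjecture d := by
  obtain ⟨m, rfl⟩ : ∃ m, d = m + 3 := ⟨d - 3, by omega⟩
  have hm : 2 ≤ m := by omega
  rw [show m + 3 - 1 = m + 2 by omega, show m + 3 - 2 = m + 1 by omega]
  refine ⟨?_, fun hconj => ?_⟩
  · intro k n hn
    obtain rfl : n = 2 * (m + 2) + (m + k + 1) * (m + 4) := by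
      rw [hn, show (m + 3) ^ 2 + (m + 3) = (m ^ 2 + 7 * m + 8) + 4 by ring, Nat.add_sub_cancel]
      ring
    obtain ⟨G, hG, hcard⟩ := exists_isHamiltonianRegular m k
    exact ⟨(iInf₂_le G hG).trans hcard, lt_haythorpeBound m k hm⟩
  -- The graph with `k = 0` already refutes the conjecture for this degree.
  · obtain ⟨G, hG, hcard⟩ := exists_isHamiltonianRegular m 0
    have h1 := hconj _ (by nlinarith) G hG
    have h2 := lt_haythorpeBound m 0 hm
    have h3 : (hamiltonianCycles G).ncard ≤ 2 * (m + 2)! ^ (m + 1) * (m + 1)! ^ 0 :=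
      ENat.toNat_le_of_le_natCast hcard
    have h4 : ((hamiltonianCycles G).ncard : ℝ) ≤
        ((2 * (m + 2)! ^ (m + 1) * (m + 1)! ^ 0 : ℕ) : ℝ) := by exact_mod_cast h3
    linarith
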